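/- Let $n\ge 2$. A convex domain in $\mathbb{R}^n$ is a nonempty open convex subset. A convex domain $D\neq\mathbb{R}^n$ is regular if its boundary $\partial D$ is a smooth ($C^\infty$) hypersurface; let $\nu_D$ be its outward unit normal. A regular convex domain $D$ is strictly convex if at every $p\in\partial D$ all normal curvatures of $\partial D$ with respect to $-\nu_D$ are positive, and $\kappa(D)\in[0,+\infty]$ denotes the supremum over $p\in\partial D$ of the largest principal curvature of $\partial D$ at $p$ with respect to $-\nu_D$. For closed sets, $K_j\to K_0$ in the Hausdorff topology means that $K_j\cap B\to K_0\cap B$ in the Hausdorff distance for every closed ball $B$ that either is disjoint from $K_0$ or has interior meeting $K_0$. Theorem. Let $C\subset\mathbb{R}^n$ be a convex domain (possibly neither bounded nor regular, possibly $C=\mathbb{R}^n$). Then there is a sequence $(C_k)_{k\in\mathbb{N}}$ of bounded regular strictly convex domains in $\mathbb{R}^n$ such that $$\overline{C_k}\subset \operatorname{int}\overline{C_{k+1}}\subset\overline{C}\quad\text{for all }k,\qquad \overline{C_k}\to\overline{C}\ \text{ in the Hausdorff topology},$$ and $$\sum_{k\in\mathbb{N}}\sqrt{\frac{\operatorname{dist}(C_k,\partial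 C_{k+1})}{\kappa(C_k)}}=+\infty .$$ -/

import Mathlib

open scoped ContDiff

noncomputable section

/-- A domain of `ℝⁿ` (nonempty, open, connected) that is convex. Connectedness follows from convexity. -/
structure IsConvexDomain {n : ℕ} (D : Set (EuclideanSpace ℝ (Fin n))) : Prop where
  nonempty : D.Nonempty
  isOpen : IsOpen D
  convex : Convex ℝ D

/-- `f` is a smooth (`C^∞`) defining function of `D` on the open neighbourhood `U` of `p`:
its gradient vanishes nowhere on `U`, and `D ∩ U = {x ∈ U | f x < 0}`. -/
structure IsDefiningFunctionAt {n : ℕ} (D : Set (EuclideanSpace ℝ (Fin n)))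
    (p : EuclideanSpace ℝ (Fin n)) (U : Set (EuclideanSpace ℝ (Fin n)))
    (f : EuclideanSpace ℝ (Fin n) → ℝ) : Prop where
  isOpen : IsOpen U
  mem : p ∈ U
  smooth : ContDiffOn ℝ ∞ f U
  gradient_ne_zero : ∀ x ∈ U, gradient f x ≠ 0
  mem_iff : ∀ x ∈ U, x ∈ D ↔ f x < 0

/-- `D` is regular: its boundary is smooth. -/
def HasSmoothBoundary {n : ℕ} (D : Set (EuclideanSpace ℝ (Fin n))) : Prop :=
  ∀ p ∈ frontier D, ∃ U f, IsDefiningFunctionAt D p U f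

/-- The unit normal field of the level sets of `f`. When `f` is a defining function of `D` near a
boundary point, its restriction to `∂D` is the outward pointing unit normal `ν_D`. -/
def unitNormal {n : ℕ} (f : EuclideanSpace ℝ (Fin n) → ℝ) (x : EuclideanSpace ℝ (Fin n)) :
    EuclideanSpace ℝ (Fin n) :=
  ‖gradient f x‖⁻¹ • gradient f x

/-- `k` is the normal curvature `⟨dν_p v, v⟩` of `∂D` at `p`, with respect to the inward normal
`-ν_D`, in the direction of the unit tangent vector `v`. (For `v` tangent to `∂D`, the value does
not depend on the defining function used to extend `ν_D`.) -/
def IsNormalCurvature {n : ℕ} (D : Set (EuclideanSpace ℝ (Fin n)))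
    (p v : EuclideanSpace ℝ (Fin n)) (k : ℝ) : Prop :=
  p ∈ frontier D ∧ ‖v‖ = 1 ∧ ∃ U f, IsDefiningFunctionAt D p U f ∧
    inner ℝ (unitNormal f p) v = 0 ∧ k = inner ℝ (fderiv ℝ (unitNormal f) p v) v

/-- `k` is a principal curvature of `∂D` at `p` with respect to `-ν_D`: an eigenvalue of the
Weingarten endomorphism `v ↦ dν_p v` of the tangent space `T_p ∂D`. -/
def IsPrincipalCurvature {n : ℕ} (D : Set (EuclideanSpace ℝ (Fin n)))
    (p : EuclideanSpace ℝ (Fin n)) (k : ℝ) : Prop :=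
  p ∈ frontier D ∧ ∃ U f, IsDefiningFunctionAt D p U f ∧
    ∃ v, v ≠ 0 ∧ inner ℝ (unitNormal f p) v = 0 ∧ fderiv ℝ (unitNormal f) p v = k • v

/-- `κ(D) ∈ [0, +∞]`: the supremum over `p ∈ ∂D` of the largest principal curvature at `p`
(principal curvatures with respect to `-ν_D` are nonnegative for convex `D`). -/
def kappa {n : ℕ} (D : Set (EuclideanSpace ℝ (Fin n))) : ENNReal :=
  ⨆ p ∈ frontier D, ⨆ (k : ℝ) (_ : IsPrincipalCurvature D p k), ENNReal.ofReal k

/-- A regular convex domain is strictly convex if all its normal curvatures are positive. -/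
def HasPositiveNormalCurvatures {n : ℕ} (D : Set (EuclideanSpace ℝ (Fin n))) : Prop :=
  ∀ p v k, IsNormalCurvature D p v k → 0 < k

/-- The Euclidean distance between two sets. -/
def setDist {n : ℕ} (A B : Set (EuclideanSpace ℝ (Fin n))) : ENNReal :=
  ⨅ x ∈ A, ⨅ y ∈ B, edist x y

/-- Convergence of closed sets in the Hausdorff topology: `K j ∩ B → K₀ ∩ B` in the Hausdorff
distance for closed balls `B`. Balls that meet `K₀` only along their bounding sphere are left out:
for those `K j ∩ B` may be empty for all `j` although `K₀ ∩ B` is not. -/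
def HausdorffConverges {n : ℕ} (K : ℕ → Set (EuclideanSpace ℝ (Fin n)))
    (K₀ : Set (EuclideanSpace ℝ (Fin n))) : Prop :=
  ∀ (c : EuclideanSpace ℝ (Fin n)) (r : ℝ),
    (Metric.ball c r ∩ K₀).Nonempty ∨ Disjoint (Metric.closedBall c r) K₀ →
    Filter.Tendsto (fun j => Metric.hausdorffEDist (K j ∩ Metric.closedBall c r)
      (K₀ ∩ Metric.closedBall c r)) Filter.atTop (nhds 0)

/-- `K j ↗ K₀`. -/
def IncreasesTo {n : ℕ} (K : ℕ → Set (EuclideanSpace ℝ (Fin n)))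
    (K₀ : Set (EuclideanSpace ℝ (Fin n))) : Prop :=
  (∀ j, K j ⊆ interior (K (j + 1)) ∧ interior (K (j + 1)) ⊆ K₀) ∧ HausdorffConverges K K₀

/-- The sequence `D` of convex domains is proper in the convex domain `C`. The series is taken in
`[0, +∞]`. -/
structure IsProperSequence {n : ℕ} (C : Set (EuclideanSpace ℝ (Fin n)))
    (D : ℕ → Set (EuclideanSpace ℝ (Fin n))) : Prop where
  convexDomain : ∀ k, IsConvexDomain (D k)
  bounded : ∀ k, Bornology.IsBounded (D k)
  regular : ∀ k, HasSmoothBoundary (D k)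
  strictlyConvex : ∀ k, HasPositiveNormalCurvatures (D k)
  increases : IncreasesTo (fun k => closure (D k)) (closure C)
  sum_eq_top : ∑' k, (setDist (D k) (frontier (D (k + 1))) / kappa (D k)) ^ (1 / 2 : ℝ) = ⊤

end

/-! Any nonempty compact K in C lies in {f < 1} for a smooth convex f with positive definite Hessian
and {f ≤ 1} ⊆ C compact. Such an f is ε‖x‖² plus finitely many exponentials of affine functions,
each negative on K and positive near a point outside C (`exists_isConvexPotential`). Its sublevel
sets above the minimum are bounded, smooth and positively curved.

Choose c < 1 above the maximum of f on K. On the slab {c ≤ f ≤ 1} the gradient is bounded by some L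
and the curvatures of the level sets by some H. Cutting the slab into N equal steps of f gives
consecutive domains at distance at least (1 - c)/(NL), so the N terms add up to at least √(N(1 -
c)/(LH)). Because of the square root this grows with N, and a single slab can contribute at least 1
(`IsConvexPotential.exists_chain`). Infinitely many such blocks, each enclosing the previous one and
a further piece of a compact exhaustion of C, make the series diverge and fill C.

The curvatures are defined through arbitrary defining functions, so positivity and the bound on
`kappa` both need that the choice is immaterial (`IsDefiningFunctionAt.fderiv_unitNormal_eq`). -/

/-! ### Independence of curvature from the defining function -/

open Filter Topology in
/-- A function with negative derivative along `w` at a zero `q` is negative at `q + t w`, for small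
`t > 0`. -/
lemma eventually_neg_of_inner_gradient_neg {n : ℕ} {f : EuclideanSpace ℝ (Fin n) → ℝ}
    {q w : EuclideanSpace ℝ (Fin n)} (hf : DifferentiableAt ℝ f q) (h0 : f q = 0)
    (hw : inner ℝ (gradient f q) w < 0) :
    ∀ᶠ t : ℝ in 𝓝[>] 0, f (q + t • w) < 0 := by
  have h1 : HasDerivAt (fun t : ℝ => f (q + t • w)) (inner ℝ (gradient f q) w) 0 := by
    have h2 : HasDerivAt (fun t : ℝ => q + t • w) w 0 := by
      simpa using ((hasDerivAt_id (0 : ℝ)).smul_const w).const_add q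
    have h3 : HasFDerivAt f (fderiv ℝ f q) (q + (0 : ℝ) • w) := by simpa using hf.hasFDerivAt
    have h4 := h3.comp_hasDerivAt (0 : ℝ) h2
    have h5 : fderiv ℝ f q w = inner ℝ (gradient f q) w := by
      rw [← toDual_gradient]; rfl
    rwa [h5] at h4
  have h2 := (hasDerivAt_iff_tendsto_slope.1 h1).eventually_lt_const hw
  have h3 : ∀ᶠ t : ℝ in 𝓝[>] 0, slope (fun t : ℝ => f (q + t • w)) 0 t < 0 :=
    h2.filter_mono (nhdsWithin_mono _ fun t (ht : 0 < t) => ht.ne')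
  filter_upwards [h3, self_mem_nhdsWithin] with t ht ht0
  rw [slope_def_field] at ht
  simp only [zero_smul, add_zero, h0, sub_zero] at ht
  by_contra! hc
  exact absurd ht (not_lt.2 (div_nonneg hc (le_of_lt ht0)))

namespace IsDefiningFunctionAt

variable {n : ℕ} {D U V : Set (EuclideanSpace ℝ (Fin n))} {f g : EuclideanSpace ℝ (Fin n) → ℝ}
  {p q v : EuclideanSpace ℝ (Fin n)}

lemma recenter (h : IsDefiningFunctionAt D p U f) (hq : q ∈ U) : IsDefiningFunctionAt D q U f :=
  ⟨h.isOpen, hq, h.smooth, h.gradient_ne_zero, h.mem_iff⟩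

lemma contDiffAt (h : IsDefiningFunctionAt D p U f) : ContDiffAt ℝ ∞ f p :=
  h.smooth.contDiffAt (h.isOpen.mem_nhds h.mem)

lemma differentiableAt (h : IsDefiningFunctionAt D p U f) : DifferentiableAt ℝ f p :=
  h.contDiffAt.differentiableAt (by simp)

open Filter Topology in
lemma eq_zero_of_mem_frontier (h : IsDefiningFunctionAt D p U f) (hD : IsOpen D)
    (hp : p ∈ frontier D) : f p = 0 := by
  rw [hD.frontier_eq] at hp
  refine le_antisymm ?_ (not_lt.1 fun hlt => hp.2 ((h.mem_iff p h.mem).2 hlt))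
  by_contra! hpos
  have h1 : ∀ᶠ x in 𝓝 p, 0 < f x := h.contDiffAt.continuousAt.eventually (lt_mem_nhds hpos)
  obtain ⟨x, ⟨hx0, hxU⟩, hxD⟩ := mem_closure_iff_nhds.1 hp.1 _
    (inter_mem h1 (h.isOpen.mem_nhds h.mem))
  exact lt_asymm hx0 ((h.mem_iff x hxU).1 hxD)

open Filter Topology in
lemma mem_of_small (h : IsDefiningFunctionAt D p U f) (w : EuclideanSpace ℝ (Fin n)) :
    ∀ᶠ t : ℝ in 𝓝[>] 0, p + t • w ∈ U := by
  have hc : Tendsto (fun t : ℝ => p + t • w) (𝓝 0) (𝓝 p) := by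
    have : Continuous fun t : ℝ => p + t • w := by fun_prop
    simpa using this.tendsto 0
  exact (hc.eventually (h.isOpen.mem_nhds h.mem)).filter_mono nhdsWithin_le_nhds

open Filter Topology in
lemma mem_frontier_of_eq_zero (h : IsDefiningFunctionAt D p U f) (h0 : f p = 0) :
    p ∈ frontier D := by
  refine ⟨mem_closure_iff_nhds.2 fun t ht => ?_, fun hi => ?_⟩
  · have hw : inner ℝ (gradient f p) (-gradient f p) < 0 := by
      rw [inner_neg_right, real_inner_self_eq_norm_sq]
      have := norm_pos_iff.2 (h.gradient_ne_zero p h.mem)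
      nlinarith
    have hc : Tendsto (fun t : ℝ => p + t • (-gradient f p)) (𝓝[>] 0) (𝓝 p) := by
      have : Continuous fun t : ℝ => p + t • (-gradient f p) := by fun_prop
      simpa using (this.tendsto 0).mono_left nhdsWithin_le_nhds
    obtain ⟨s, hs1, hs2, hs3⟩ := ((hc.eventually ht).and
      ((eventually_neg_of_inner_gradient_neg h.differentiableAt h0 hw).and
        (h.mem_of_small _))).exists
    exact ⟨_, hs1, (h.mem_iff _ hs3).2 hs2⟩
  · have := (h.mem_iff p h.mem).1 (interior_subset hi)
    exact this.ne h0

open Filter Topology in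
/-- The unit normal on the boundary does not depend on the defining function. -/
lemma unitNormal_eq (hf : IsDefiningFunctionAt D p U f) (hg : IsDefiningFunctionAt D p V g)
    (hD : IsOpen D) (hp : p ∈ frontier D) : unitNormal f p = unitNormal g p := by
  have hnf := norm_pos_iff.2 (hf.gradient_ne_zero p hf.mem)
  have hng := norm_pos_iff.2 (hg.gradient_ne_zero p hg.mem)
  have h1f : ‖unitNormal f p‖ = 1 := by simp [unitNormal, norm_smul, hnf.ne']
  have h1g : ‖unitNormal g p‖ = 1 := by simp [unitNormal, norm_smul, hng.ne']
  by_contra hne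
  have hlt : inner ℝ (unitNormal f p) (unitNormal g p) < 1 :=
    (inner_lt_one_iff_real_of_norm_eq_one h1f h1g).2 hne
  -- If the unit normals differ, moving along their difference decreases f and increases g, so
  -- nearby points would lie both in D and outside it.
  set w := unitNormal g p - unitNormal f p
  have hwf : inner ℝ (gradient f p) w < 0 := by
    have : inner ℝ (unitNormal f p) w < 0 := by
      rw [inner_sub_right, real_inner_self_eq_norm_sq, h1f]; linarith
    rw [unitNormal, real_inner_smul_left] at this
    exact neg_of_mul_neg_right this (inv_nonneg.2 hnf.le)
  have hwg : inner ℝ (gradient g p) (-w) < 0 := by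
    have : inner ℝ (unitNormal g p) (-w) < 0 := by
      rw [inner_neg_right, inner_sub_right, real_inner_self_eq_norm_sq, h1g, real_inner_comm]
      linarith
    rw [unitNormal, real_inner_smul_left] at this
    exact neg_of_mul_neg_right this (inv_nonneg.2 hng.le)
  have hg0 := hg.eq_zero_of_mem_frontier hD hp
  have e1 := eventually_neg_of_inner_gradient_neg hf.differentiableAt
    (hf.eq_zero_of_mem_frontier hD hp) hwf
  have hgrad : gradient (fun x => -g x) p = -gradient g p := by
    simp [gradient, fderiv_fun_neg]
  have e2 := eventually_neg_of_inner_gradient_neg (f := fun x => -g x) (w := w)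
    hg.differentiableAt.neg (by simp [hg0]) (by rw [hgrad]; simpa using hwg)
  obtain ⟨t, ht1, ht2, ht3, ht4⟩ :=
    (e1.and (e2.and ((hf.mem_of_small w).and (hg.mem_of_small w)))).exists
  have := (hg.mem_iff _ ht4).1 ((hf.mem_iff _ ht3).2 ht1)
  linarith

lemma contDiffAt_gradient (h : IsDefiningFunctionAt D p U f) : ContDiffAt ℝ ∞ (gradient f) p :=
  (InnerProductSpace.toDual ℝ _).symm.toContinuousLinearEquiv.contDiff.contDiffAt.comp p
    (h.contDiffAt.fderiv_right (by simp))

lemma differentiableAt_unitNormal (h : IsDefiningFunctionAt D p U f) :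
    DifferentiableAt ℝ (unitNormal f) p := by
  have h1 : DifferentiableAt ℝ (gradient f) p := h.contDiffAt_gradient.differentiableAt (by simp)
  have h0 := h.gradient_ne_zero p h.mem
  exact ((h1.norm ℝ h0).inv (norm_ne_zero_iff.2 h0)).smul h1

open Filter Topology in
/-- A tangent vector at a boundary point is the velocity of a curve in the boundary. -/
lemma exists_curve (h : IsDefiningFunctionAt D p U f) (hD : IsOpen D) (hp : p ∈ frontier D)
    (hv : inner ℝ (unitNormal f p) v = 0) :
    ∃ γ : ℝ → EuclideanSpace ℝ (Fin n), γ 0 = p ∧ HasDerivAt γ v 0 ∧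
      ∀ᶠ t in 𝓝 0, γ t ∈ frontier D := by
  have h0 := h.gradient_ne_zero p h.mem
  have hs : HasStrictFDerivAt f (fderiv ℝ f p) p := h.contDiffAt.hasStrictFDerivAt (by simp)
  have happ : ∀ w, fderiv ℝ f p w = inner ℝ (gradient f p) w := fun w => by
    rw [← toDual_gradient]; rfl
  have hr : (fderiv ℝ f p).range = ⊤ := by
    refine LinearMap.range_eq_top.2 fun y => ⟨(y / ‖gradient f p‖ ^ 2) • gradient f p, ?_⟩
    have := norm_ne_zero_iff.2 h0
    change fderiv ℝ f p _ = y
    rw [happ, real_inner_smul_right, real_inner_self_eq_norm_sq]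
    field_simp
  have hk : v ∈ (fderiv ℝ f p).ker := by
    change fderiv ℝ f p v = 0
    rw [unitNormal, real_inner_smul_left] at hv
    rw [happ]
    exact (mul_eq_zero.1 hv).resolve_left (inv_ne_zero (norm_ne_zero_iff.2 h0))
  let k : (fderiv ℝ f p).ker := ⟨v, hk⟩
  -- The implicit function theorem parametrises the level set of f by the kernel of its
  -- differential; γ is the image of the line spanned by v.
  let γ : ℝ → EuclideanSpace ℝ (Fin n) := fun t => hs.implicitFunction f _ hr (f p) (t • k)
  have hγ0 : γ 0 = p := by
    simp [γ]
  have hd : HasDerivAt γ v 0 := by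
    have h1 := (hs.to_implicitFunction hr).hasFDerivAt
    have h2 : HasDerivAt (fun t : ℝ => t • k) k 0 := by
      simpa using (hasDerivAt_id (0 : ℝ)).smul_const k
    have h3 : HasFDerivAt (hs.implicitFunction f (fderiv ℝ f p) hr (f p))
      (fderiv ℝ f p).ker.subtypeL ((0 : ℝ) • k) := by simpa using h1
    exact h3.comp_hasDerivAt (0 : ℝ) h2
  refine ⟨γ, hγ0, hd, ?_⟩
  have hc : Tendsto γ (𝓝 0) (𝓝 p) := by
    have := hd.continuousAt.tendsto
    rwa [hγ0] at this
  have hc2 : Tendsto (fun t : ℝ => (f p, t • k)) (𝓝 0) (𝓝 (f p, 0)) := by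
    have : Continuous fun t : ℝ => (f p, t • k) := by fun_prop
    simpa using this.tendsto 0
  filter_upwards [hc.eventually (h.isOpen.mem_nhds h.mem),
    hc2.eventually (hs.map_implicitFunction_eq hr)] with t htU hteq
  exact (h.recenter htU).mem_frontier_of_eq_zero
    (hteq.trans (h.eq_zero_of_mem_frontier hD hp))

open Filter Topology in
/-- The Weingarten map does not depend on the defining function. -/
lemma fderiv_unitNormal_eq (hf : IsDefiningFunctionAt D p U f)
    (hg : IsDefiningFunctionAt D p V g) (hD : IsOpen D) (hp : p ∈ frontier D)
    (hv : inner ℝ (unitNormal f p) v = 0) :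
    fderiv ℝ (unitNormal f) p v = fderiv ℝ (unitNormal g) p v := by
  obtain ⟨γ, hγ0, hγ, hγD⟩ := hf.exists_curve hD hp hv
  have hc : Tendsto γ (𝓝 0) (𝓝 p) := by
    have := hγ.continuousAt.tendsto
    rwa [hγ0] at this
  have h1 : HasDerivAt (unitNormal f ∘ γ) (fderiv ℝ (unitNormal f) p v) 0 :=
    HasFDerivAt.comp_hasDerivAt (0 : ℝ) (by
      rw [hγ0]; exact hf.differentiableAt_unitNormal.hasFDerivAt) hγ
  have h2 : HasDerivAt (unitNormal g ∘ γ) (fderiv ℝ (unitNormal g) p v) 0 :=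
    HasFDerivAt.comp_hasDerivAt (0 : ℝ) (by
      rw [hγ0]; exact hg.differentiableAt_unitNormal.hasFDerivAt) hγ
  -- The curve stays in the boundary, where the two unit normals coincide, so they have the same
  -- derivative along it.
  refine h1.unique (h2.congr_of_eventuallyEq ?_)
  filter_upwards [hγD, hc.eventually (hf.isOpen.mem_nhds hf.mem),
    hc.eventually (hg.isOpen.mem_nhds hg.mem)] with t htD htU htV
  exact (hf.recenter htU).unitNormal_eq (hg.recenter htV) hD htD

/-- The second fundamental form is the Hessian of the defining function over the length of its
gradient. -/
lemma inner_fderiv_unitNormal (h : IsDefiningFunctionAt D p U f)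
    (hv : inner ℝ (unitNormal f p) v = 0) :
    inner ℝ (fderiv ℝ (unitNormal f) p v) v =
      ‖gradient f p‖⁻¹ * inner ℝ (fderiv ℝ (gradient f) p v) v := by
  have h1 : DifferentiableAt ℝ (gradient f) p := h.contDiffAt_gradient.differentiableAt (by simp)
  have h0 := h.gradient_ne_zero p h.mem
  have h2 : DifferentiableAt ℝ (fun x => ‖gradient f x‖⁻¹) p :=
    (h1.norm ℝ h0).inv (norm_ne_zero_iff.2 h0)
  have h3 : HasFDerivAt (unitNormal f) _ p := h2.hasFDerivAt.smul h1.hasFDerivAt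
  have hv' : inner ℝ (gradient f p) v = 0 := by
    rw [unitNormal, real_inner_smul_left] at hv
    exact (mul_eq_zero.1 hv).resolve_left (inv_ne_zero (norm_ne_zero_iff.2 h0))
  -- Differentiating the factor ‖∇f‖⁻¹ only yields a multiple of ∇f, which is orthogonal to v.
  rw [h3.fderiv]
  simp [inner_add_left, real_inner_smul_left, hv']

end IsDefiningFunctionAt

/-! ### Convex potentials and sums of exponentials -/

/-- A smooth convex function with positive definite Hessian and compact sublevel sets. -/
structure IsConvexPotential {n : ℕ} (f : EuclideanSpace ℝ (Fin n) → ℝ) : Prop where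
  contDiff : ContDiff ℝ ∞ f
  convexOn : ConvexOn ℝ Set.univ f
  le_of_gradient : ∀ x y, f x + inner ℝ (gradient f x) (y - x) ≤ f y
  hessian_pos : ∀ x v, v ≠ 0 → 0 < inner ℝ (fderiv ℝ (gradient f) x v) v
  isCompact_sublevel : ∀ c, IsCompact {x | f x ≤ c}

/-- A sum of exponentials of affine functions and a multiple of the squared norm. -/
noncomputable def expSum {n : ℕ} {ι : Type*} (s : Finset ι) (a : ι → EuclideanSpace ℝ (Fin n)) (b : ι → ℝ)
    (ε : ℝ) (x : EuclideanSpace ℝ (Fin n)) : ℝ :=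
  ∑ i ∈ s, Real.exp (inner ℝ (a i) x + b i) + ε * ‖x‖ ^ 2

section expSum

variable {n : ℕ} {ι : Type*} (s : Finset ι) (a : ι → EuclideanSpace ℝ (Fin n)) (b : ι → ℝ) (ε : ℝ)

lemma contDiff_expSum : ContDiff ℝ ∞ (expSum s a b ε) := by
  unfold expSum
  refine ContDiff.add (ContDiff.sum fun i _ => ?_) (contDiff_const.mul (contDiff_norm_sq ℝ))
  exact ((contDiff_const.inner ℝ contDiff_id).add contDiff_const).exp

lemma hasGradientAt_expSum (x : EuclideanSpace ℝ (Fin n)) :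
    HasGradientAt (expSum s a b ε)
      (∑ i ∈ s, Real.exp (inner ℝ (a i) x + b i) • a i + (2 * ε) • x) x := by
  rw [hasGradientAt_iff_hasFDerivAt]
  have h1 : ∀ i ∈ s, HasFDerivAt (fun x => Real.exp (inner ℝ (a i) x + b i))
      (Real.exp (inner ℝ (a i) x + b i) • (innerSL ℝ (a i))) x := fun i _ =>
    (((innerSL ℝ (a i)).hasFDerivAt (x := x)).add_const (b i)).exp
  have h2 : HasFDerivAt (fun x : EuclideanSpace ℝ (Fin n) => ε * ‖x‖ ^ 2)
      (ε • (2 • innerSL ℝ x)) x := (hasStrictFDerivAt_norm_sq x).hasFDerivAt.const_mul ε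
  refine ((HasFDerivAt.fun_sum h1).add h2).congr_fderiv ?_
  ext v
  simp
  ring

lemma hasFDerivAt_gradient_expSum (x : EuclideanSpace ℝ (Fin n)) :
    HasFDerivAt (gradient (expSum s a b ε))
      (∑ i ∈ s, (Real.exp (inner ℝ (a i) x + b i) • innerSL ℝ (a i)).smulRight (a i) +
        (2 * ε) • ContinuousLinearMap.id ℝ _) x := by
  rw [gradient_eq (hasGradientAt_expSum s a b ε)]
  have h1 : ∀ i ∈ s, HasFDerivAt (fun x => Real.exp (inner ℝ (a i) x + b i) • a i)
      ((Real.exp (inner ℝ (a i) x + b i) • innerSL ℝ (a i)).smulRight (a i)) x := fun i _ =>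
    (((innerSL ℝ (a i)).hasFDerivAt (x := x)).add_const (b i)).exp.smul_const (a i)
  exact (HasFDerivAt.fun_sum h1).add ((hasFDerivAt_id x).const_smul (2 * ε))

/-- Each exponential satisfies this by 1 + t ≤ exp t; for the quadratic term the defect is ε‖y -
x‖². -/
lemma expSum_add_inner_le (hε : 0 ≤ ε) (x y : EuclideanSpace ℝ (Fin n)) :
    expSum s a b ε x + inner ℝ (gradient (expSum s a b ε) x) (y - x) ≤ expSum s a b ε y := by
  rw [gradient_eq (hasGradientAt_expSum s a b ε)]
  have h1 : ∀ i ∈ s, Real.exp (inner ℝ (a i) x + b i) +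
      Real.exp (inner ℝ (a i) x + b i) * inner ℝ (a i) (y - x) ≤
        Real.exp (inner ℝ (a i) y + b i) := fun i _ => by
    have h2 : Real.exp (inner ℝ (a i) y + b i) =
        Real.exp (inner ℝ (a i) x + b i) * Real.exp (inner ℝ (a i) (y - x)) := by
      rw [← Real.exp_add, inner_sub_right]; ring_nf
    have h3 := Real.add_one_le_exp (inner ℝ (a i) (y - x))
    rw [h2]
    nlinarith [Real.exp_pos (inner ℝ (a i) x + b i)]
  have h4 := Finset.sum_le_sum h1
  rw [Finset.sum_add_distrib] at h4
  have h5 : ‖y‖ ^ 2 = ‖x‖ ^ 2 + 2 * inner ℝ x (y - x) + ‖y - x‖ ^ 2 := by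
    rw [← norm_add_sq_real]; simp
  simp only [expSum, inner_add_left, sum_inner, real_inner_smul_left]
  rw [h5]
  nlinarith [mul_nonneg hε (sq_nonneg ‖y - x‖)]

lemma convexOn_expSum (hε : 0 ≤ ε) : ConvexOn ℝ Set.univ (expSum s a b ε) := by
  refine ⟨convex_univ, fun x _ y _ t u ht hu htu => ?_⟩
  set z := t • x + u • y
  have hx := expSum_add_inner_le s a b ε hε z x
  have hy := expSum_add_inner_le s a b ε hε z y
  have hz : t * inner ℝ (gradient (expSum s a b ε) z) (x - z) +
      u * inner ℝ (gradient (expSum s a b ε) z) (y - z) = 0 := by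
    rw [← real_inner_smul_right, ← real_inner_smul_right, ← inner_add_right]
    have : t • (x - z) + u • (y - z) = 0 := by
      rw [smul_sub, smul_sub, sub_add_sub_comm, ← add_smul, htu, one_smul, sub_self]
    rw [this, inner_zero_right]
  rw [smul_eq_mul, smul_eq_mul]
  have h1 := mul_le_mul_of_nonneg_left hx ht
  have h2 := mul_le_mul_of_nonneg_left hy hu
  have h3 : t * expSum s a b ε z + u * expSum s a b ε z = expSum s a b ε z := by
    rw [← add_mul, htu, one_mul]
  linarith

/-- The term ε‖x‖² supplies both definiteness of the Hessian and compactness of sublevel sets; the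
exponentials only add nonnegative contributions. -/
lemma isConvexPotential_expSum (hε : 0 < ε) : IsConvexPotential (expSum s a b ε) where
  contDiff := contDiff_expSum s a b ε
  convexOn := convexOn_expSum s a b ε hε.le
  le_of_gradient := expSum_add_inner_le s a b ε hε.le
  hessian_pos x v hv := by
    rw [(hasFDerivAt_gradient_expSum s a b ε x).fderiv]
    have h1 : inner ℝ ((∑ i ∈ s, (Real.exp (inner ℝ (a i) x + b i) •
        innerSL ℝ (a i)).smulRight (a i) + (2 * ε) • ContinuousLinearMap.id ℝ (EuclideanSpace ℝ (Fin n))) v) v =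
        ∑ i ∈ s, Real.exp (inner ℝ (a i) x + b i) * (inner ℝ (a i) v) ^ 2 +
          2 * ε * ‖v‖ ^ 2 := by
      simp only [add_apply, sum_apply, inner_add_left,
        sum_inner, ContinuousLinearMap.smulRight_apply, smul_apply,
        real_inner_smul_left, ContinuousLinearMap.id_apply, real_inner_self_eq_norm_sq,
        innerSL_apply_apply, smul_eq_mul]
      simp [pow_two, mul_assoc]
    rw [h1]
    have h2 : 0 ≤ ∑ i ∈ s, Real.exp (inner ℝ (a i) x + b i) * (inner ℝ (a i) v) ^ 2 :=
      Finset.sum_nonneg fun i _ => by positivity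
    have h3 := norm_pos_iff.2 hv
    positivity
  isCompact_sublevel c := by
    -- Either ‖x‖ ≤ 1, or ‖x‖ ≤ ‖x‖² ≤ c / ε.
    refine (isCompact_closedBall (0 : EuclideanSpace ℝ (Fin n)) (max 1 (c / ε))).of_isClosed_subset
      (isClosed_le (contDiff_expSum s a b ε).continuous continuous_const) fun x hx => ?_
    have h1 : 0 ≤ ∑ i ∈ s, Real.exp (inner ℝ (a i) x + b i) :=
      Finset.sum_nonneg fun i _ => by positivity
    have h2 : ε * ‖x‖ ^ 2 ≤ c := le_trans (le_add_of_nonneg_left h1) hx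
    rw [mem_closedBall_zero_iff, le_max_iff]
    by_contra! hc
    have h3 : ‖x‖ ≤ ‖x‖ ^ 2 := by nlinarith
    have h4 : ‖x‖ ^ 2 ≤ c / ε := by rw [le_div_iff₀ hε]; linarith
    linarith

end expSum

/-! ### Separating a compact set from the complement of C -/

open Filter Topology in
/-- A compact subset of an open convex set `C` can be separated from the complement of `C` by a
sublevel set of a convex potential. -/
lemma exists_isConvexPotential {n : ℕ} {C K : Set (EuclideanSpace ℝ (Fin n))}
    (hC : IsConvexDomain C) (hK : IsCompact K) (hKC : K ⊆ C) (hKne : K.Nonempty) :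
    ∃ f, IsConvexPotential f ∧ (∀ x ∈ K, f x < 1) ∧ {x | f x ≤ 1} ⊆ C := by
  obtain ⟨R, hR⟩ := hK.isBounded.exists_norm_le
  -- Half of the budget 1 on K goes to the quadratic term, half to the exponentials.
  obtain ⟨ε, hε, hεK⟩ : ∃ ε : ℝ, 0 < ε ∧ ∀ x ∈ K, ε * ‖x‖ ^ 2 < 1 / 2 := by
    refine ⟨1 / (2 * (R ^ 2 + 1)), by positivity, fun x hx => ?_⟩
    have h1 : ‖x‖ ^ 2 ≤ R ^ 2 := by
      have := hR x hx
      have := norm_nonneg x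
      nlinarith
    rw [one_div_mul_eq_div, div_lt_div_iff₀ (by positivity) (by positivity)]
    nlinarith
  -- Where ε‖x‖² > 1 the potential already exceeds 1, so exponentials are needed only on this
  -- compact remainder.
  have hY : IsCompact ({x : EuclideanSpace ℝ (Fin n) | ε * ‖x‖ ^ 2 ≤ 1} ∩ Cᶜ) := by
    have := (isConvexPotential_expSum (∅ : Finset ℕ) (fun _ => (0 : EuclideanSpace ℝ (Fin n)))
      (fun _ => 0) ε hε).isCompact_sublevel 1
    simp only [expSum, Finset.sum_empty, zero_add] at this
    exact this.inter_right hC.isOpen.isClosed_compl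
  have hsep : ∀ y : EuclideanSpace ℝ (Fin n), ∃ (a : EuclideanSpace ℝ (Fin n)) (b m : ℝ), y ∉ C →
      0 < m ∧ (∀ x ∈ K, inner ℝ a x + b ≤ -m) ∧ 0 < inner ℝ a y + b := by
    intro y
    by_cases hy : y ∈ C
    · exact ⟨0, 0, 0, fun h => absurd hy h⟩
    obtain ⟨l, hl⟩ := geometric_hahn_banach_open_point hC.convex hC.isOpen hy
    obtain ⟨x₀, hx₀, hmax⟩ := hK.exists_isMaxOn hKne l.continuous.continuousOn
    have h1 := hl x₀ (hKC hx₀)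
    have h2 : ∀ x, inner ℝ ((InnerProductSpace.toDual ℝ _).symm l) x = l x := fun x =>
      InnerProductSpace.toDual_symm_apply
    -- The affine function vanishes halfway between the maximum of l on K and its value at y; m is
    -- half the gap.
    refine ⟨(InnerProductSpace.toDual ℝ _).symm l, -(l x₀ + l y) / 2, (l y - l x₀) / 2, fun _ =>
      ⟨by linarith, fun x hx => ?_, ?_⟩⟩
    · have h3 : l x ≤ l x₀ := hmax hx
      rw [h2]; linarith
    · rw [h2]; linarith
  choose a b m hab using hsep
  obtain ⟨s, hsC, hs⟩ := hY.elim_nhds_subcover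
    (fun y => {x | 0 < inner ℝ (a y) x + b y}) fun y hy =>
      (isOpen_lt continuous_const (by fun_prop)).mem_nhds (hab y hy.2).2.2
  -- Scaling the affine functions by N makes the exponentials small on K, while they stay above 1
  -- wherever the affine functions are positive.
  have hlim : Tendsto (fun N : ℝ => ∑ y ∈ s, Real.exp (-(N * m y))) atTop (𝓝 0) := by
    have : Tendsto (fun N : ℝ => ∑ y ∈ s, Real.exp (-(N * m y))) atTop (𝓝 (∑ y ∈ s, 0)) := by
      refine tendsto_finsetSum s fun y hy => ?_
      exact Real.tendsto_exp_neg_atTop_nhds_zero.comp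
        (tendsto_id.atTop_mul_const (hab y (hsC y hy).2).1)
    simpa using this
  obtain ⟨N, hN, hN0⟩ := ((hlim.eventually_lt_const (show (0 : ℝ) < 1 / 2 by norm_num)).and
    (eventually_gt_atTop 0)).exists
  refine ⟨expSum s (fun y => N • a y) (fun y => N * b y) ε,
    isConvexPotential_expSum _ _ _ _ hε, fun x hx => ?_, fun x hx => ?_⟩
  · have h1 : ∑ y ∈ s, Real.exp (inner ℝ (N • a y) x + N * b y) ≤
        ∑ y ∈ s, Real.exp (-(N * m y)) := Finset.sum_le_sum fun y hy => by
      rw [Real.exp_le_exp, real_inner_smul_left]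
      have := (hab y (hsC y hy).2).2.1 x hx
      nlinarith
    have h2 := hεK x hx
    rw [expSum]; linarith
  · by_contra hxC
    have h0 : ∀ y ∈ s, 0 ≤ Real.exp (inner ℝ (N • a y) x + N * b y) := fun y _ => by positivity
    have h1 : expSum s (fun y => N • a y) (fun y => N * b y) ε x ≤ 1 := hx
    rw [expSum] at h1
    have h2 := Finset.sum_nonneg h0
    obtain ⟨y, hys, hy⟩ := Set.mem_iUnion₂.1 (hs ⟨by
      change ε * ‖x‖ ^ 2 ≤ 1
      linarith, hxC⟩)
    have h3 := Finset.single_le_sum h0 hys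
    have h4 : 1 < Real.exp (inner ℝ (N • a y) x + N * b y) := by
      rw [Real.one_lt_exp_iff, real_inner_smul_left, ← mul_add]
      exact mul_pos hN0 hy
    nlinarith [mul_nonneg hε.le (sq_nonneg ‖x‖)]

/-! ### Sublevel sets: curvature, distance, chains -/

/-- A bounded regular strictly convex domain. -/
structure IsBoundedStrictlyConvex {n : ℕ} (D : Set (EuclideanSpace ℝ (Fin n))) : Prop where
  convexDomain : IsConvexDomain D
  bounded : Bornology.IsBounded D
  regular : HasSmoothBoundary D
  strictlyConvex : HasPositiveNormalCurvatures D

namespace IsConvexPotential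

variable {n : ℕ} {f : EuclideanSpace ℝ (Fin n) → ℝ} {c : ℝ} {p x₀ : EuclideanSpace ℝ (Fin n)}

lemma isOpen_sublevel (hf : IsConvexPotential f) (c : ℝ) : IsOpen {x | f x < c} :=
  isOpen_lt hf.contDiff.continuous continuous_const

lemma closure_sublevel_subset (hf : IsConvexPotential f) (c : ℝ) :
    closure {x | f x < c} ⊆ {x | f x ≤ c} :=
  closure_minimal (fun x (hx : f x < c) => hx.le) (isClosed_le hf.contDiff.continuous continuous_const)

lemma eq_of_mem_frontier (hf : IsConvexPotential f) (hp : p ∈ frontier {x | f x < c}) :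
    f p = c := by
  rw [(hf.isOpen_sublevel c).frontier_eq] at hp
  exact le_antisymm (hf.closure_sublevel_subset c hp.1) (not_lt.1 hp.2)

/-- A critical point of a function lying above its tangent planes is a global minimum. -/
lemma gradient_ne_zero (hf : IsConvexPotential f) (h : f x₀ < f p) : gradient f p ≠ 0 := by
  intro h0
  have := hf.le_of_gradient p x₀
  rw [h0, inner_zero_left] at this
  linarith

lemma contDiff_gradient (hf : IsConvexPotential f) : ContDiff ℝ ∞ (gradient f) :=
  (InnerProductSpace.toDual ℝ _).symm.toContinuousLinearEquiv.contDiff.comp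
    (hf.contDiff.fderiv_right (by simp))

lemma gradient_sub_const (f : EuclideanSpace ℝ (Fin n) → ℝ) (c : ℝ) :
    gradient (fun x => f x - c) = gradient f := by
  ext1 x
  simp [gradient, fderiv_sub_const]

lemma isDefiningFunctionAt (hf : IsConvexPotential f) (h : f x₀ < f p) :
    IsDefiningFunctionAt {x | f x < c} p {x | gradient f x ≠ 0} (fun x => f x - c) where
  isOpen := isOpen_ne_fun hf.contDiff_gradient.continuous continuous_const
  mem := hf.gradient_ne_zero h
  smooth := (hf.contDiff.sub contDiff_const).contDiffOn
  gradient_ne_zero x hx := by rwa [gradient_sub_const]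
  mem_iff x _ := by simp

lemma inner_fderiv_unitNormal_eq (hf : IsConvexPotential f) (hx₀ : f x₀ < c)
    {U : Set (EuclideanSpace ℝ (Fin n))} {g : EuclideanSpace ℝ (Fin n) → ℝ}
    {v : EuclideanSpace ℝ (Fin n)} (hp : p ∈ frontier {x | f x < c})
    (hg : IsDefiningFunctionAt {x | f x < c} p U g) (hv : inner ℝ (unitNormal g p) v = 0) :
    inner ℝ (fderiv ℝ (unitNormal g) p v) v =
      ‖gradient f p‖⁻¹ * inner ℝ (fderiv ℝ (gradient f) p v) v := by
  have hd := hf.isDefiningFunctionAt (c := c) (p := p) (x₀ := x₀)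
    (by rwa [hf.eq_of_mem_frontier hp])
  rw [hg.fderiv_unitNormal_eq hd (hf.isOpen_sublevel c) hp hv, hd.inner_fderiv_unitNormal,
    gradient_sub_const]
  rwa [hd.unitNormal_eq hg (hf.isOpen_sublevel c) hp]

lemma isBoundedStrictlyConvex (hf : IsConvexPotential f) (hx₀ : f x₀ < c) :
    IsBoundedStrictlyConvex {x | f x < c} where
  convexDomain := ⟨⟨x₀, hx₀⟩, hf.isOpen_sublevel c, by simpa using hf.convexOn.convex_lt c⟩
  bounded := (hf.isCompact_sublevel c).isBounded.subset fun x (hx : f x < c) => hx.le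
  regular p hp := ⟨_, _, hf.isDefiningFunctionAt (x₀ := x₀) (by rwa [hf.eq_of_mem_frontier hp])⟩
  strictlyConvex p v k := by
    rintro ⟨hp, hv1, U, g, hg, hv, rfl⟩
    rw [hf.inner_fderiv_unitNormal_eq hx₀ hp hg hv]
    have h0 := hf.gradient_ne_zero (x₀ := x₀) (p := p) (by rwa [hf.eq_of_mem_frontier hp])
    exact mul_pos (inv_pos.2 (norm_pos_iff.2 h0))
      (hf.hessian_pos p v (norm_ne_zero_iff.1 (by rw [hv1]; exact one_ne_zero)))

lemma kappa_le (hf : IsConvexPotential f) (hx₀ : f x₀ < c) {H : ℝ}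
    (hH : ∀ p, f p = c → ‖gradient f p‖⁻¹ * ‖fderiv ℝ (gradient f) p‖ ≤ H) :
    kappa {x | f x < c} ≤ ENNReal.ofReal H := by
  refine iSup₂_le fun p hp => iSup₂_le fun k hk => ENNReal.ofReal_le_ofReal ?_
  obtain ⟨-, U, g, hg, v, hv0, hv, hkv⟩ := hk
  have h1 := hf.inner_fderiv_unitNormal_eq hx₀ hp hg hv
  rw [hkv, real_inner_smul_left, real_inner_self_eq_norm_sq] at h1
  have h2 : inner ℝ (fderiv ℝ (gradient f) p v) v ≤ ‖fderiv ℝ (gradient f) p‖ * ‖v‖ ^ 2 := by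
    refine (real_inner_le_norm _ _).trans ?_
    have := mul_le_mul_of_nonneg_right ((fderiv ℝ (gradient f) p).le_opNorm v) (norm_nonneg v)
    linarith
  have h3 : 0 < ‖v‖ ^ 2 := pow_pos (norm_pos_iff.2 hv0) 2
  refine le_of_mul_le_mul_right ?_ h3
  calc k * ‖v‖ ^ 2 ≤ ‖gradient f p‖⁻¹ * (‖fderiv ℝ (gradient f) p‖ * ‖v‖ ^ 2) := by
        rw [h1]; exact mul_le_mul_of_nonneg_left h2 (by positivity)
    _ = ‖gradient f p‖⁻¹ * ‖fderiv ℝ (gradient f) p‖ * ‖v‖ ^ 2 := by ring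
    _ ≤ H * ‖v‖ ^ 2 := mul_le_mul_of_nonneg_right (hH p (hf.eq_of_mem_frontier hp)) h3.le

/-- The tangent plane inequality is applied at the point y of the outer boundary, so the gradient
need only be bounded on the level c'. -/
lemma le_setDist (hf : IsConvexPotential f) {c' L : ℝ} (hL : 0 < L)
    (hbound : ∀ p, f p = c' → ‖gradient f p‖ ≤ L) :
    ENNReal.ofReal ((c' - c) / L) ≤ setDist {x | f x < c} (frontier {x | f x < c'}) := by
  refine le_iInf₂ fun x hx => le_iInf₂ fun y hy => ?_
  rw [edist_dist]
  refine ENNReal.ofReal_le_ofReal ?_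
  have hy' := hf.eq_of_mem_frontier hy
  have hx' : f x < c := hx
  have h1 := hf.le_of_gradient y x
  have h2 : inner ℝ (gradient f y) (y - x) ≤ L * ‖y - x‖ := (real_inner_le_norm _ _).trans
    (mul_le_mul_of_nonneg_right (hbound y hy') (norm_nonneg _))
  rw [← neg_sub y x, inner_neg_right] at h1
  rw [div_le_iff₀ hL, dist_eq_norm, norm_sub_rev]
  linarith

/-- Between two levels of a convex potential one can insert finitely many levels contributing at
least `1` to the series. -/
lemma exists_chain (hf : IsConvexPotential f) (hx₀ : f x₀ < c) (hc : c < 1) :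
    ∃ (N : ℕ) (D : ℕ → Set (EuclideanSpace ℝ (Fin n))), D 0 = {x | f x < c} ∧
      (∀ j, IsBoundedStrictlyConvex (D j)) ∧ (∀ j, closure (D j) ⊆ D (j + 1)) ∧
      closure (D N) ⊆ {x | f x ≤ 1} ∧
      1 ≤ ∑ j ∈ Finset.range N,
        (setDist (D j) (frontier (D (j + 1))) / kappa (D j)) ^ (1 / 2 : ℝ) := by
  have hcomp : IsCompact {x | c ≤ f x ∧ f x ≤ 1} :=
    (hf.isCompact_sublevel 1).inter_left (isClosed_le continuous_const hf.contDiff.continuous)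
  obtain ⟨L, hL0, hL⟩ : ∃ L > 0, ∀ p, c ≤ f p → f p ≤ 1 → ‖gradient f p‖ ≤ L := by
    obtain ⟨L, hL⟩ := hcomp.exists_bound_of_continuousOn
      hf.contDiff_gradient.continuous.continuousOn
    exact ⟨max L 1, by positivity, fun p h1 h2 => (hL p ⟨h1, h2⟩).trans (le_max_left _ _)⟩
  obtain ⟨H, hH0, hH⟩ : ∃ H > 0, ∀ p, c ≤ f p → f p ≤ 1 →
      ‖gradient f p‖⁻¹ * ‖fderiv ℝ (gradient f) p‖ ≤ H := by
    have h1 : ContinuousOn (fun p => ‖gradient f p‖⁻¹ * ‖fderiv ℝ (gradient f) p‖)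
        {x | c ≤ f x ∧ f x ≤ 1} := by
      refine ContinuousOn.mul (ContinuousOn.inv₀
        hf.contDiff_gradient.continuous.norm.continuousOn fun p hp => ?_)
        (hf.contDiff_gradient.continuous_fderiv (by simp)).norm.continuousOn
      exact norm_ne_zero_iff.2 (hf.gradient_ne_zero (hx₀.trans_le hp.1))
    obtain ⟨H, hH⟩ := hcomp.exists_bound_of_continuousOn h1
    exact ⟨max H 1, by positivity, fun p h1 h2 =>
      (le_abs_self _).trans ((hH p ⟨h1, h2⟩).trans (le_max_left _ _))⟩
  -- With δ = (1 - c)/N, a term is at least √(δ/(LH)), which is at least 1/N once N ≥ LH/(1 - c).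
  -- The 1 keeps N positive.
  obtain ⟨N, hN⟩ := exists_nat_ge (max 1 (L * H / (1 - c)))
  have hN0 : (0 : ℝ) < N := lt_of_lt_of_le one_pos ((le_max_left _ _).trans hN)
  set δ := (1 - c) / N
  have hδ : 0 < δ := div_pos (sub_pos.2 hc) hN0
  have hNδ : N * δ = 1 - c := by simp only [δ]; field_simp
  -- The bounds L and H hold only in the slab. Levels with j > N exist merely to make D total, and
  -- may leave it.
  have hlev : ∀ j : ℕ, j ≤ N → c ≤ c + j * δ ∧ c + j * δ ≤ 1 := fun j hj => by
    have h1 : (j : ℝ) ≤ N := by exact_mod_cast hj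
    have h2 : 0 ≤ (j : ℝ) * δ := by positivity
    exact ⟨by linarith, by nlinarith⟩
  refine ⟨N, fun j => {x | f x < c + j * δ}, by simp, fun j => ?_, fun j => ?_, ?_, ?_⟩
  · refine hf.isBoundedStrictlyConvex (hx₀.trans_le ?_)
    have : 0 ≤ (j : ℝ) * δ := by positivity
    linarith
  · refine (hf.closure_sublevel_subset _).trans fun x hx => ?_
    have hx' : f x ≤ c + j * δ := hx
    change f x < c + ((j + 1 : ℕ) : ℝ) * δ
    push_cast
    linarith
  · refine (hf.closure_sublevel_subset _).trans fun x hx => ?_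
    exact le_trans hx (hlev N le_rfl).2
  · have hterm : ∀ j ∈ Finset.range N, ENNReal.ofReal (1 / N) ≤
        (setDist {x | f x < c + j * δ} (frontier {x | f x < c + ((j + 1 : ℕ) : ℝ) * δ}) /
          kappa {x | f x < c + j * δ}) ^ (1 / 2 : ℝ) := fun j hj => by
      have hj' := Finset.mem_range.1 hj
      obtain ⟨ha, hb⟩ := hlev j hj'.le
      obtain ⟨ha', hb'⟩ := hlev (j + 1) hj'
      have h1 := hf.kappa_le (c := c + j * δ) (hx₀.trans_le ha) (H := H)
        fun p hp => hH p (by rwa [hp]) (by rwa [hp])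
      have h2 := hf.le_setDist (c := c + j * δ) (c' := c + ((j + 1 : ℕ) : ℝ) * δ) hL0
        fun p hp => hL p (by rwa [hp]) (by rwa [hp])
      have h3 : (c + ((j + 1 : ℕ) : ℝ) * δ - (c + j * δ)) / L = δ / L := by push_cast; ring
      rw [h3] at h2
      have h4 : ENNReal.ofReal (1 / N) ^ (2 : ℝ) ≤ ENNReal.ofReal (δ / L) / ENNReal.ofReal H := by
        rw [← ENNReal.ofReal_div_of_pos hH0, ENNReal.ofReal_rpow_of_pos (by positivity)]
        refine ENNReal.ofReal_le_ofReal ?_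
        have h5 : L * H ≤ N * (1 - c) := by
          have := (le_max_right _ _).trans hN
          rwa [div_le_iff₀ (sub_pos.2 hc)] at this
        rw [Real.rpow_two, div_div, div_pow, one_pow, div_le_div_iff₀ (by positivity)
          (by positivity), one_mul]
        calc L * H ≤ N * (1 - c) := h5
          _ = δ * N ^ 2 := by rw [← hNδ]; ring
      calc ENNReal.ofReal (1 / N) = (ENNReal.ofReal (1 / N) ^ (2 : ℝ)) ^ (1 / 2 : ℝ) := by
            rw [← ENNReal.rpow_mul]; norm_num
        _ ≤ _ := ENNReal.rpow_le_rpow (h4.trans (ENNReal.div_le_div h2 h1)) (by norm_num)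
    calc (1 : ENNReal) = ∑ j ∈ Finset.range N, ENNReal.ofReal (1 / N) := by
          rw [Finset.sum_const, Finset.card_range, nsmul_eq_mul, ← ENNReal.ofReal_natCast,
            ← ENNReal.ofReal_mul hN0.le, mul_one_div_cancel hN0.ne', ENNReal.ofReal_one]
      _ ≤ _ := Finset.sum_le_sum hterm

end IsConvexPotential

/-! ### Hausdorff convergence of an exhaustion -/

open Filter Topology in
/-- An increasing exhaustion of an open convex set converges in the Hausdorff topology. -/
lemma increasesTo_of_exhaustion {n : ℕ} {C : Set (EuclideanSpace ℝ (Fin n))}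
    {D : ℕ → Set (EuclideanSpace ℝ (Fin n))} (hC : IsConvexDomain C) (hDo : ∀ k, IsOpen (D k))
    (hD : ∀ k, closure (D k) ⊆ D (k + 1)) (hDC : ⋃ k, D k = C) :
    IncreasesTo (fun k => closure (D k)) (closure C) := by
  have hsub : ∀ k, D k ⊆ C := fun k => hDC ▸ Set.subset_iUnion D k
  have hmono : Monotone D := monotone_nat_of_le_succ fun k => subset_closure.trans (hD k)
  refine ⟨fun j => ⟨(hD j).trans (interior_maximal subset_closure (hDo _)),
    interior_subset.trans (closure_mono (hsub _))⟩, fun c r hcr => ?_⟩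
  rcases hcr with ⟨z₀, hz₀b, hz₀⟩ | hdisj
  · obtain ⟨z, hzb, hzC⟩ := mem_closure_iff_nhds.1 hz₀ _ (Metric.isOpen_ball.mem_nhds hz₀b)
    -- Segments from a point of the closures to z, which is interior to both sets, consist of
    -- interior points apart from their start.
    have hdense : closure C ∩ Metric.closedBall c r ⊆ closure (C ∩ Metric.ball c r) := by
      rintro x ⟨hxC, hxb⟩
      have hr : r ≠ 0 := by
        rintro rfl
        simp at hzb
      have h1 : ∀ t ∈ Set.Ioc (0 : ℝ) 1, (1 - t) • x + t • z ∈ C ∩ Metric.ball c r := by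
        intro t ht
        have ht1 : 0 ≤ 1 - t := by linarith [ht.2]
        constructor
        · have := hC.convex.combo_closure_interior_mem_interior hxC
            (y := z) (by rwa [hC.isOpen.interior_eq]) ht1 ht.1 (by ring)
          exact interior_subset this
        · have := (convex_closedBall c r).combo_closure_interior_mem_interior
            (subset_closure hxb) (y := z) (by rwa [interior_closedBall c hr]) ht1 ht.1 (by ring)
          rwa [interior_closedBall c hr] at this
      have h2 : Tendsto (fun t : ℝ => (1 - t) • x + t • z) (𝓝[>] 0) (𝓝 x) := by
        have : Continuous fun t : ℝ => (1 - t) • x + t • z := by fun_prop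
        simpa using (this.tendsto 0).mono_left nhdsWithin_le_nhds
      exact mem_closure_of_tendsto h2
        (eventually_of_mem (Ioc_mem_nhdsGT one_pos) h1)
    rw [ENNReal.tendsto_nhds_zero]
    intro ε hε
    have hcomp : IsCompact (closure C ∩ Metric.closedBall c r) :=
      (isCompact_closedBall c r).inter_left isClosed_closure
    -- The ε-neighbourhoods increase with k, so by compactness a single one covers; this is the
    -- nontrivial half of the Hausdorff estimate.
    have hcover : closure C ∩ Metric.closedBall c r ⊆
        ⋃ k, ⋃ y ∈ D k ∩ Metric.ball c r, Metric.eball y ε := by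
      intro x hx
      obtain ⟨y, ⟨hyC, hyb⟩, hy⟩ := EMetric.mem_closure_iff.1 (hdense hx) ε hε
      rw [← hDC] at hyC
      obtain ⟨k, hk⟩ := Set.mem_iUnion.1 hyC
      exact Set.mem_iUnion.2 ⟨k, Set.mem_iUnion₂.2 ⟨y, ⟨hk, hyb⟩, hy⟩⟩
    obtain ⟨k, hk⟩ := hcomp.elim_directed_cover _
      (fun k => isOpen_biUnion fun _ _ => Metric.isOpen_eball) hcover
      (Monotone.directed_le fun i j hij => Set.biUnion_subset_biUnion_left
        (Set.inter_subset_inter_left _ (hmono hij)))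
    filter_upwards [eventually_ge_atTop k] with j hj
    refine Metric.hausdorffEDist_le_of_mem_edist
      (fun x hx => ⟨x, ⟨closure_mono (hsub j) hx.1, hx.2⟩, by simp⟩) fun x hx => ?_
    obtain ⟨y, hy, hxy⟩ := Set.mem_iUnion₂.1 (hk hx)
    exact ⟨y, ⟨subset_closure (hmono hj hy.1), Metric.ball_subset_closedBall hy.2⟩, le_of_lt hxy⟩
  · have h0 : closure C ∩ Metric.closedBall c r = ∅ :=
      Set.disjoint_iff_inter_eq_empty.1 hdisj.symm
    have h1 : ∀ j, closure (D j) ∩ Metric.closedBall c r = ∅ := fun j =>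
      Set.subset_empty_iff.1 (h0 ▸ Set.inter_subset_inter_left _ (closure_mono (hsub j)))
    simp only [h0, h1, Metric.hausdorffEDist_self]
    exact tendsto_const_nhds

/-! ### Concatenating the blocks -/

/-- Successor in the lexicographic enumeration of the pairs `(m, j)` with `j ≤ N m`. -/
def blockSucc (N : ℕ → ℕ) (s : ℕ × ℕ) : ℕ × ℕ :=
  if s.2 < N s.1 then (s.1, s.2 + 1) else (s.1 + 1, 0)

/-- The position at which the `m`-th block starts. -/
def blockStart (N : ℕ → ℕ) (m : ℕ) : ℕ := ∑ i ∈ Finset.range m, (N i + 1)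

lemma blockSucc_iterate (N : ℕ → ℕ) (m : ℕ) :
    ∀ j ≤ N m, (blockSucc N)^[blockStart N m + j] (0, 0) = (m, j) := by
  induction m with
  | zero =>
    intro j hj
    induction j with
    | zero => rfl
    | succ j ih =>
      rw [← add_assoc, Function.iterate_succ_apply', ih (by omega), blockSucc, if_pos (Nat.lt_of_succ_le hj)]
  | succ m ihm =>
    intro j hj
    induction j with
    | zero =>
      have h1 : blockStart N (m + 1) + 0 = blockStart N m + N m + 1 := by
        rw [blockStart, Finset.sum_range_succ, blockStart]; omega
      rw [h1, Function.iterate_succ_apply', ihm _ le_rfl, blockSucc, if_neg (lt_irrefl _)]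
    | succ j ih =>
      rw [← add_assoc, Function.iterate_succ_apply', ih (by omega), blockSucc, if_pos (Nat.lt_of_succ_le hj)]

lemma blockSucc_iterate_le (N : ℕ → ℕ) (k : ℕ) :
    ((blockSucc N)^[k] (0, 0)).2 ≤ N ((blockSucc N)^[k] (0, 0)).1 := by
  induction k with
  | zero => simp
  | succ k _ =>
    rw [Function.iterate_succ_apply', blockSucc]
    split_ifs with h
    · exact h
    · exact Nat.zero_le _

/-- If every block contributes at least `1`, the concatenated series diverges. -/
lemma tsum_blockSucc_eq_top (N : ℕ → ℕ) (F : ℕ × ℕ → ℕ × ℕ → ENNReal)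
    (hF : ∀ m, 1 ≤ ∑ j ∈ Finset.range (N m), F (m, j) (m, j + 1)) :
    ∑' k, F ((blockSucc N)^[k] (0, 0)) ((blockSucc N)^[k + 1] (0, 0)) = ⊤ := by
  have hle : ∀ m : ℕ, (m : ENNReal) ≤ ∑ k ∈ Finset.range (blockStart N m),
      F ((blockSucc N)^[k] (0, 0)) ((blockSucc N)^[k + 1] (0, 0)) := by
    intro m
    induction m with
    | zero => simp
    | succ m ih =>
      have h1 : blockStart N (m + 1) = blockStart N m + (N m + 1) := by
        rw [blockStart, Finset.sum_range_succ, blockStart]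
      rw [h1, Finset.sum_range_add, Nat.cast_succ]
      refine add_le_add ih ((hF m).trans ?_)
      -- A block has N m + 1 domains but N m inner gaps; the remaining term, linking it to the next
      -- block, is discarded.
      rw [Finset.sum_range_succ]
      refine le_add_of_le_of_nonneg (Finset.sum_le_sum fun j hj => ?_) zero_le
      have hj' := Finset.mem_range.1 hj
      rw [blockSucc_iterate N m j hj'.le, add_assoc, blockSucc_iterate N m (j + 1) hj']
  refine ENNReal.eq_top_of_forall_nnreal_le fun r => ?_
  obtain ⟨m, hm⟩ := exists_nat_ge r
  calc (r : ENNReal) ≤ m := by exact_mod_cast hm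
    _ ≤ _ := (hle m).trans (ENNReal.sum_le_tsum _)

/-- A compact subset of a convex domain `C` can be enclosed in a finite chain of bounded strictly
convex domains in `C` contributing at least `1` to the series. -/
lemma exists_block {n : ℕ} {C K : Set (EuclideanSpace ℝ (Fin n))} (hC : IsConvexDomain C)
    (hK : IsCompact K ∧ K.Nonempty ∧ K ⊆ C) :
    ∃ (N : ℕ) (D : ℕ → Set (EuclideanSpace ℝ (Fin n))) (K' : Set (EuclideanSpace ℝ (Fin n))),
      (IsCompact K' ∧ K'.Nonempty ∧ K' ⊆ C) ∧ K ⊆ D 0 ∧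
      (∀ j, IsBoundedStrictlyConvex (D j)) ∧ (∀ j, closure (D j) ⊆ D (j + 1)) ∧
      closure (D N) ⊆ K' ∧
      1 ≤ ∑ j ∈ Finset.range N,
        (setDist (D j) (frontier (D (j + 1))) / kappa (D j)) ^ (1 / 2 : ℝ) := by
  obtain ⟨hKc, hKne, hKC⟩ := hK
  obtain ⟨f, hf, hfK, hfC⟩ := exists_isConvexPotential hC hKc hKC hKne
  obtain ⟨x₀, hx₀, hmax⟩ := hKc.exists_isMaxOn hKne hf.contDiff.continuous.continuousOn
  obtain ⟨c, hc0, hc1⟩ := exists_between (hfK x₀ hx₀)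
  obtain ⟨N, D, hD0, hD, hDD, hDN, hsum⟩ := hf.exists_chain hc0 hc1
  refine ⟨N, D, {x | f x ≤ 1}, ⟨hf.isCompact_sublevel 1, ⟨x₀, (hfK x₀ hx₀).le⟩, hfC⟩, ?_, hD, hDD,
    hDN, hsum⟩
  rw [hD0]
  exact fun x hx => lt_of_le_of_lt (hmax hx) hc0

/-! ### Assembling the sequence -/

theorem mainTheorem6 (n : ℕ) (hn : 2 ≤ n) (C : Set (EuclideanSpace ℝ (Fin n)))
    (hC : IsConvexDomain C) :
    ∃ D : ℕ → Set (EuclideanSpace ℝ (Fin n)), IsProperSequence C D := by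
  obtain ⟨x₀, hx₀⟩ := hC.nonempty
  obtain ⟨E, hEc, hEC⟩ : IsSigmaCompact C := by
    have := hC.isOpen.locallyCompactSpace
    exact isSigmaCompact_iff_sigmaCompactSpace.2 inferInstance
  have hEsub : ∀ m, E m ⊆ C := fun m => hEC ▸ Set.subset_iUnion E m
  choose! N D K' hK' hKD hD hDD hDN hsum using
    fun (K : Set (EuclideanSpace ℝ (Fin n))) hK => exists_block (K := K) hC hK
  -- `K'` makes the next block enclose the current one; E m makes the blocks exhaust C.
  let K : ℕ → Set (EuclideanSpace ℝ (Fin n)) :=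
    fun m => Nat.rec {x₀} (fun m S => K' S ∪ E m) m
  have hK : ∀ m, IsCompact (K m) ∧ (K m).Nonempty ∧ K m ⊆ C := fun m => by
    induction m with
    | zero => exact ⟨isCompact_singleton, Set.singleton_nonempty x₀, Set.singleton_subset_iff.2 hx₀⟩
    | succ m ih =>
      obtain ⟨h1, h2, h3⟩ := hK' _ ih
      exact ⟨h1.union (hEc m), h2.inl, Set.union_subset h3 (hEsub m)⟩
  let M : ℕ → ℕ := fun m => N (K m)
  let G : ℕ × ℕ → Set (EuclideanSpace ℝ (Fin n)) := fun s => D (K s.1) s.2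
  let s : ℕ → ℕ × ℕ := fun k => (blockSucc M)^[k] (0, 0)
  have hG : ∀ p, IsBoundedStrictlyConvex (G p) := fun p => hD _ (hK _) _
  have hnext : ∀ k, closure (G (s k)) ⊆ G (s (k + 1)) := fun k => by
    have h1 := blockSucc_iterate_le M k
    have h2 : s (k + 1) = blockSucc M (s k) := Function.iterate_succ_apply' _ _ _
    rw [h2, blockSucc]
    split_ifs with h
    · exact hDD _ (hK _) _
    · have h3 : (s k).2 = M (s k).1 := le_antisymm h1 (not_lt.1 h)
      simp only [G, h3]
      exact (hDN _ (hK _)).trans (Set.subset_union_left.trans (hKD _ (hK ((s k).1 + 1))))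
  -- The restriction on p matters: past its last index a chain may leave C.
  have hGC : ∀ p : ℕ × ℕ, p.2 ≤ M p.1 → G p ⊆ C := fun p hp => by
    have h1 : ∀ j, D (K p.1) j ⊆ D (K p.1) (j + 1) := fun j =>
      subset_closure.trans (hDD _ (hK _) j)
    exact (monotone_nat_of_le_succ h1 hp).trans
      (subset_closure.trans ((hDN _ (hK _)).trans (hK' _ (hK _)).2.2))
  have hunion : ⋃ k, G (s k) = C := by
    refine Set.Subset.antisymm (Set.iUnion_subset fun k => hGC _ (blockSucc_iterate_le M k)) ?_
    rw [← hEC]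
    refine Set.iUnion_subset fun m => ?_
    have h1 : s (blockStart M (m + 1) + 0) = (m + 1, 0) :=
      blockSucc_iterate M (m + 1) 0 (Nat.zero_le _)
    refine Set.subset_iUnion_of_subset (blockStart M (m + 1) + 0) ?_
    rw [h1]
    exact Set.subset_union_right.trans (hKD _ (hK (m + 1)))
  exact ⟨fun k => G (s k), fun k => (hG _).convexDomain, fun k => (hG _).bounded,
    fun k => (hG _).regular, fun k => (hG _).strictlyConvex,
    increasesTo_of_exhaustion hC (fun k => (hG _).convexDomain.isOpen) hnext hunion,
    tsum_blockSucc_eq_top M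
      (fun p q => (setDist (G p) (frontier (G q)) / kappa (G p)) ^ (1 / 2 : ℝ))
      fun m => hsum _ (hK m)⟩
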